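/- A map in a category is a cover if the only subobject of its codomain through which it factors is the maximal one; a commutative square $D\to B$, $D\to C$, $B\to A$, $C\to A$ is a quasi-pullback if the induced map $D\to B\times_A C$ is a cover. A $\Pi W$-pretopos is a locally cartesian closed category that is exact (with pullback-stable quotients), has finite disjoint and stable sums, and in which every polynomial functor $P_f(X)=\sum_{a\in A}X^{B_a}$ (for $f:B\to A$) has an initial algebra. Let $\mathbf E$ be a $\Pi W$-pretopos. A class of small maps in $\mathbf E$ is a class $S$ of maps such that: $S$ is stable under pullback; $S$ descends along pullback along epis; $S$ is closed under binary sums $f+f'$; in a commuting triangle $h=f\circ g$ with $f\in S$ one has $g\in S$ if and only if $h\in S$; for every object $X$ the full subcategory $S_X\subseteq\mathbf E/X$ on the objects belonging to $S$ is a $\Pi W$-pretopos and the inclusion $S_X\to\mathbf E/X$ preserves the $\Pi W$-pretopos structure; and $S$ is representable, i.e. there is $\pi:V\to U$ in $S$ such that for every $f:B\to A$ in $S$ there are an epi $A'\to A$ and a map $A'\to U$ along which $f$ and $\pi$ have isomorphic pullbacks over $A'$. It satisfies collection if for all small $f:A\to X$ and every epi $c:C\to A$ there are a small map $g:B\to Y$,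 a map $b:B\to C$ and an epi $Y\to X$ such that $cb$, $g$, $f$, $Y\to X$ form a quasi-pullback. A site in $\mathbf E$ consists of an internal category $\mathbf C$ (with objects $C_0$, arrows $C_1$) and a commutative square $$\begin{array}{ccc}\underline{\mathrm{Cov}}&\xrightarrow{\,m\,}&C_1\\ {\scriptstyle\phi}\downarrow&&\downarrow{\scriptstyle\mathrm{cod}}\\ \mathrm{Cov}&\longrightarrow&C_0\end{array}$$ (so that each $U\in\mathrm{Cov}$ over $C\in C_0$ names a family of arrows into $C$ indexed by the fibre $\underline{\mathrm{Cov}}_U$) such that, in the internal logic: for any covering family $(\alpha_i:C_i\to C\mid i\in I)$ and any arrow $f:D\to C$ there is a covering family $(\beta_j:D_j\to D\mid j\in J)$ such that every $f\beta_j$ factors through some $\alpha_i$. The site has small covers if $\phi$ is small. It is a collection site if $(\phi,m)$ is a collection span over $C_0$, where a span $C\xleftarrow{g}D\xrightarrow{h}B$ is a collection span if, in the internal logic, for every $c\in C$ and every map $F\to D_c$ covering the fibre of $g$ over $c$, there is a fibre $D_{c'}$ of $g$ with a cover $D_{c'}\to D_c$ over $B$ that factors through $F\to D_c$; over $C_0$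 means that this is taken in $\mathbf E/C_0$. An internal presheaf on $\mathbf C$ is a sheaf for a site if, in the internal logic, every compatible family of elements on a covering family has a unique amalgamation. Two sites with the same underlying category $\mathbf C$ are equivalent if their categories of internal sheaves are equivalent, compatibly with the inclusions into internal presheaves on $\mathbf C$. Proposition. Let $\mathbf E$ be a $\Pi W$-pretopos equipped with a class of small maps satisfying collection. Then for every site in $\mathbf E$ with small covers there exists an equivalent collection site with small covers and the same underlying category. -/

import Mathlib

open CategoryTheory CategoryTheory.Limits

universe v u v₁ u₁

namespace PredTopos

/-! ## Covers, quasi-pullbacks, pretoposes -/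

section Basic

variable {C : Type u} [Category.{v} C]

/-- A map is a cover when the only subobject of its codomain through which it factors is the
maximal one. -/
def IsCover {X Y : C} (f : X ⟶ Y) : Prop :=
  ∀ ⦃I : C⦄ (p : X ⟶ I) (i : I ⟶ Y), Mono i → p ≫ i = f → IsIso i

/-- The square with sides `fst : P ⟶ X`, `snd : P ⟶ Y`, `f : X ⟶ Z`, `g : Y ⟶ Z` commutes, and the
induced map from `P` to the pullback of `f` and `g` is a cover. -/
def IsQuasiPullback [HasPullbacks C] {P X Y Z : C}
    (fst : P ⟶ X) (snd : P ⟶ Y) (f : X ⟶ Z) (g : Y ⟶ Z) : Prop :=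
  ∃ w : fst ≫ f = snd ≫ g, IsCover (pullback.lift fst snd w)

variable (C) in
/-- A pretopos: an exact category (a regular category in which every equivalence relation has a
quotient of which it is the kernel pair, stably under pullback) with finite disjoint and stable
sums. -/
class Pretopos : Prop extends Regular C, FinitaryExtensive C where
  universallyEffective : ∀ ⦃R X : C⦄ (p₁ p₂ : R ⟶ X), IsEquivalenceRelation p₁ p₂ →
    IsUniversallyEffectiveEquivalenceRelation p₁ p₂

variable (C) in
/-- Local cartesian closure: all pullback functors `f* : C/A ⥤ C/B` have right adjoints. -/
class LocallyCartesianClosed [HasPullbacks C] : Prop where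
  isLeftAdjoint : ∀ ⦃B A : C⦄ (f : B ⟶ A), (Over.pullback f).IsLeftAdjoint

/-! ## Dependent products and W-types, by their universal properties -/

/-- `p : P ⟶ A` is the dependent product `Π_f (y : Y ⟶ B)` along `f : B ⟶ A`. Here `Q` is the
pullback `f* P`, with projections `q` and `b`, and `e : Q ⟶ Y` is the evaluation map (the counit of
`f* ⊣ Π_f`). The universal property says that for every `z : Z ⟶ A` with pullback `T = f* Z`, maps
`h : T ⟶ Y` over `B` correspond to maps `g : Z ⟶ P` over `A`, by `h = f*(g) ≫ e`. -/
structure IsDependentProduct {B A Y P Q : C} (f : B ⟶ A) (y : Y ⟶ B)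
    (p : P ⟶ A) (q : Q ⟶ P) (b : Q ⟶ B) (e : Q ⟶ Y) : Prop where
  isPullback : IsPullback q b p f
  w : e ≫ y = b
  existsUnique : ∀ ⦃Z T : C⦄ (z : Z ⟶ A) (t : T ⟶ Z) (c : T ⟶ B), IsPullback t c z f →
    ∀ h : T ⟶ Y, h ≫ y = c →
      ∃! g : Z ⟶ P, g ≫ p = z ∧
        ∃ k : T ⟶ Q, k ≫ q = t ≫ g ∧ k ≫ b = c ∧ k ≫ e = h

/-- `P` is the value `P_f(X) = Σ_{a ∈ A} X^{B_a}` of the polynomial functor of `f : B ⟶ A` at `X`.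
Here `p : P ⟶ A` is the projection, `Q = P ×_A B` has projections `q` and `b`, and `e : Q ⟶ X` is
evaluation, `((a, t), b) ↦ t b`. The universal property says that maps `Z ⟶ P` correspond to pairs
of a map `z : Z ⟶ A` and a map `h : Z ×_A B ⟶ X`. -/
structure IsPolynomialObject {B A X P Q : C} (f : B ⟶ A)
    (p : P ⟶ A) (q : Q ⟶ P) (b : Q ⟶ B) (e : Q ⟶ X) : Prop where
  isPullback : IsPullback q b p f
  existsUnique : ∀ ⦃Z T : C⦄ (z : Z ⟶ A) (t : T ⟶ Z) (c : T ⟶ B), IsPullback t c z f →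
    ∀ h : T ⟶ X,
      ∃! g : Z ⟶ P, g ≫ p = z ∧
        ∃ k : T ⟶ Q, k ≫ q = t ≫ g ∧ k ≫ b = c ∧ k ≫ e = h

/-- An algebra `str : P_f(X) ⟶ X` for the polynomial functor of `f`, with the object `P = P_f(X)`
given by its universal property. -/
structure PolyAlgebra {B A : C} (f : B ⟶ A) where
  {X P Q : C}
  p : P ⟶ A
  q : Q ⟶ P
  b : Q ⟶ B
  e : Q ⟶ X
  isPolynomialObject : IsPolynomialObject f p q b e
  str : P ⟶ X

namespace PolyAlgebra

variable {B A : C} {f : B ⟶ A}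

/-- `u` is an algebra map: `str ≫ u = P_f(u) ≫ str`. The map `k` is `P_f(u)`, the map over `A`
that corresponds to the composite of evaluation with `u`. -/
def IsHom (M N : PolyAlgebra f) (w : M.X ⟶ N.X) : Prop :=
  ∃ (k : M.P ⟶ N.P) (l : M.Q ⟶ N.Q), k ≫ N.p = M.p ∧ l ≫ N.q = M.q ≫ k ∧ l ≫ N.b = M.b ∧
    l ≫ N.e = M.e ≫ w ∧ M.str ≫ w = k ≫ N.str

/-- The algebra is initial, that is, it is the W-type of `f`. -/
def IsWType (M : PolyAlgebra f) : Prop :=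
  ∀ N : PolyAlgebra f, ∃! w : M.X ⟶ N.X, M.IsHom N w

end PolyAlgebra

variable (C) in
/-- A ΠW-pretopos: a locally cartesian closed pretopos with W-types for all maps. -/
class PiWPretopos : Prop extends Pretopos C, LocallyCartesianClosed C where
  exists_isWType : ∀ ⦃B A : C⦄ (f : B ⟶ A), ∃ W : PolyAlgebra f, W.IsWType

/-- A functor preserves the structure of a ΠW-pretopos: finite limits, finite sums, quotients
(the quotient maps are the regular epimorphisms), dependent products and W-types. -/
structure PreservesPiWPretopos {D : Type u₁} [Category.{v₁} D] (F : C ⥤ D) : Prop where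
  finiteLimits : PreservesFiniteLimits F
  finiteCoproducts : PreservesFiniteCoproducts F
  regularEpi : ∀ ⦃X Y : C⦄ (f : X ⟶ Y), IsRegularEpi f → IsRegularEpi (F.map f)
  dependentProduct : ∀ ⦃B A Y P Q : C⦄ (f : B ⟶ A) (y : Y ⟶ B)
    (p : P ⟶ A) (q : Q ⟶ P) (b : Q ⟶ B) (e : Q ⟶ Y), IsDependentProduct f y p q b e →
      IsDependentProduct (F.map f) (F.map y) (F.map p) (F.map q) (F.map b) (F.map e)
  wType : ∀ ⦃B A : C⦄ (f : B ⟶ A) (W : PolyAlgebra f), W.IsWType →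
    ∃ h : IsPolynomialObject (F.map f) (F.map W.p) (F.map W.q) (F.map W.b) (F.map W.e),
      PolyAlgebra.IsWType
        { p := F.map W.p, q := F.map W.q, b := F.map W.b, e := F.map W.e,
          isPolynomialObject := h, str := F.map W.str }

end Basic

/-! ## Classes of small maps -/

section Small

variable {E : Type u} [Category.{v} E]

/-- Stable classes of maps: pullback stability, descent along epis, and sums. -/
structure IsStableClass [HasFiniteCoproducts E] (S : MorphismProperty E) : Prop where
  pullback : ∀ ⦃D C B A : E⦄ (d : D ⟶ C) (g : D ⟶ B) (f : C ⟶ A) (p : B ⟶ A),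
    IsPullback d g f p → S f → S g
  descent : ∀ ⦃D C B A : E⦄ (d : D ⟶ C) (g : D ⟶ B) (f : C ⟶ A) (p : B ⟶ A),
    IsPullback d g f p → Epi p → S g → S f
  sum : ∀ ⦃B A B' A' : E⦄ (f : B ⟶ A) (f' : B' ⟶ A'), S f → S f' → S (coprod.map f f')

/-- Locally full subcategories: stable classes such that in a commuting triangle `h = g ≫ f` with
`f` in the class, `g` is in the class if and only if `h` is. -/
structure IsLocallyFullSubcategory [HasFiniteCoproducts E] (S : MorphismProperty E) : Prop
    extends IsStableClass S where
  triangle : ∀ ⦃C B A : E⦄ (g : C ⟶ B) (f : B ⟶ A), S f → (S g ↔ S (g ≫ f))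

/-- The full subcategory `S_X` of `E/X` on the objects that belong to `S`. -/
abbrev SmallOver (S : MorphismProperty E) (X : E) := (S.overObj (X := X)).FullSubcategory

/-- Classes of small maps in `E`. -/
structure IsClassOfSmallMaps [PiWPretopos E] (S : MorphismProperty E) : Prop
    extends IsLocallyFullSubcategory S where
  piWPretopos : ∀ X : E, PiWPretopos (SmallOver S X)
  preserves : ∀ X : E, PreservesPiWPretopos (S.overObj (X := X)).ι

/-- There is a universal small map `π : V ⟶ U`: every map in `S` fits into a double pullback
diagram with `π` on the right and an epi below on the left. -/
def IsRepresentable (S : MorphismProperty E) : Prop :=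
  ∃ (V U : E) (π : V ⟶ U), S π ∧
    ∀ ⦃B A : E⦄ (f : B ⟶ A), S f →
      ∃ (B' A' : E) (f' : B' ⟶ A') (b : B' ⟶ B) (p : A' ⟶ A) (c : B' ⟶ V) (u : A' ⟶ U),
        Epi p ∧ IsPullback b f' f p ∧ IsPullback c f' π u

/-- The collection axiom (CA). -/
def SatisfiesCollection [HasPullbacks E] (S : MorphismProperty E) : Prop :=
  ∀ ⦃A X C : E⦄ (f : A ⟶ X) (c : C ⟶ A), S f → Epi c →
    ∃ (B Y : E) (g : B ⟶ Y) (b : B ⟶ C) (y : Y ⟶ X),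
      S g ∧ Epi y ∧ IsQuasiPullback (b ≫ c) g f y

/-- The span `C ⟵g⟵ D ⟶h⟶ B` is a collection span: internally, for every `c` in `C` and every map
`e : F ⟶ D_c` covering the fibre of `g` over `c`, there are `c'` in `C` and a covering map
`D_{c'} ⟶ D_c` over `B` that factors through `e`. Externally, `c` is a map `T ⟶ C` with fibre
`T ×_C D`, and `c'` is a map defined on an epi `T' ⟶ T`. -/
def IsCollectionSpan [HasPullbacks E] {C D B : E} (g : D ⟶ C) (h : D ⟶ B) : Prop :=
  ∀ ⦃T F : E⦄ (c : T ⟶ C) (e : F ⟶ pullback c g), Epi e →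
    ∃ (T' : E) (t : T' ⟶ T) (c' : T' ⟶ C) (r : pullback c' g ⟶ F),
      Epi t ∧
      IsQuasiPullback (r ≫ e) (pullback.fst c' g) (pullback.fst c g) t ∧
      pullback.snd c' g ≫ h = (r ≫ e) ≫ pullback.snd c g ≫ h

/-- The span `(g, h)` of objects and maps over `A` is a collection span over `A`, that is, a
collection span in the slice `E/A`. The structure maps of `C`, `D`, `B` are `γ`, `g ≫ γ`, `β`. -/
def IsCollectionSpanOver [HasPullbacks E] {A C D B : E} (γ : C ⟶ A) (β : B ⟶ A)
    (g : D ⟶ C) (h : D ⟶ B) (w : h ≫ β = g ≫ γ) : Prop :=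
  IsCollectionSpan (E := Over A)
    (Over.homMk g rfl : Over.mk (g ≫ γ) ⟶ Over.mk γ)
    (Over.homMk h w : Over.mk (g ≫ γ) ⟶ Over.mk β)

end Small

/-! ## Internal categories, presheaves, sites and sheaves -/

section Internal

variable (E : Type u) [Category.{v} E] [HasPullbacks E]

/-- Internal categories in `E`. The map `comp` sends a pair `(α, β)` with `cod α = dom β` to the
composite `β ∘ α`. The unit and associativity laws are stated for generalised elements. -/
structure InternalCategory where
  C₀ : E
  C₁ : E
  dom : C₁ ⟶ C₀
  cod : C₁ ⟶ C₀
  id : C₀ ⟶ C₁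
  comp : pullback cod dom ⟶ C₁
  id_dom : id ≫ dom = 𝟙 C₀
  id_cod : id ≫ cod = 𝟙 C₀
  comp_dom : comp ≫ dom = pullback.fst cod dom ≫ dom
  comp_cod : comp ≫ cod = pullback.snd cod dom ≫ cod
  id_comp : ∀ ⦃T : E⦄ (α : T ⟶ C₁) (w : (α ≫ dom ≫ id) ≫ cod = α ≫ dom),
    pullback.lift (α ≫ dom ≫ id) α w ≫ comp = α
  comp_id : ∀ ⦃T : E⦄ (α : T ⟶ C₁) (w : α ≫ cod = (α ≫ cod ≫ id) ≫ dom),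
    pullback.lift α (α ≫ cod ≫ id) w ≫ comp = α
  assoc : ∀ ⦃T : E⦄ (α β γ : T ⟶ C₁) (w₁ : α ≫ cod = β ≫ dom) (w₂ : β ≫ cod = γ ≫ dom)
    (w₁' : (pullback.lift α β w₁ ≫ comp) ≫ cod = γ ≫ dom)
    (w₂' : α ≫ cod = (pullback.lift β γ w₂ ≫ comp) ≫ dom),
    pullback.lift (pullback.lift α β w₁ ≫ comp) γ w₁' ≫ comp =
      pullback.lift α (pullback.lift β γ w₂ ≫ comp) w₂' ≫ comp

variable {E}

namespace InternalCategory

variable (C : InternalCategory E)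

/-- The composite `β ∘ α` of generalised elements of `C₁`. -/
noncomputable def compose {T : E} (α β : T ⟶ C.C₁) (w : α ≫ C.cod = β ≫ C.dom) : T ⟶ C.C₁ :=
  pullback.lift α β w ≫ C.comp

/-- Internal presheaves: an object `anchor : P ⟶ C₀` over `C₀` with an action that sends `(x, α)`
with `x` in `P(cod α)` to `x · α` in `P(dom α)`. -/
structure Presheaf where
  P : E
  anchor : P ⟶ C.C₀
  act : pullback anchor C.cod ⟶ P
  act_anchor : act ≫ anchor = pullback.snd anchor C.cod ≫ C.dom
  act_id : ∀ ⦃T : E⦄ (x : T ⟶ P) (w : x ≫ anchor = (x ≫ anchor ≫ C.id) ≫ C.cod),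
    pullback.lift x (x ≫ anchor ≫ C.id) w ≫ act = x
  act_comp : ∀ ⦃T : E⦄ (x : T ⟶ P) (α β : T ⟶ C.C₁) (w : α ≫ C.cod = β ≫ C.dom)
    (w₁ : x ≫ anchor = β ≫ C.cod)
    (w₂ : (pullback.lift x β w₁ ≫ act) ≫ anchor = α ≫ C.cod)
    (w₃ : x ≫ anchor = C.compose α β w ≫ C.cod),
    pullback.lift x (C.compose α β w) w₃ ≫ act =
      pullback.lift (pullback.lift x β w₁ ≫ act) α w₂ ≫ act

namespace Presheaf

variable {C}

/-- The restriction `x · α` of generalised elements. -/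
noncomputable def restrict (P : C.Presheaf) {T : E} (x : T ⟶ P.P) (α : T ⟶ C.C₁)
    (w : x ≫ P.anchor = α ≫ C.cod) : T ⟶ P.P :=
  pullback.lift x α w ≫ P.act

/-- Morphisms of internal presheaves: maps over `C₀` that commute with the actions. -/
@[ext]
structure Hom (P Q : C.Presheaf) where
  f : P.P ⟶ Q.P
  f_anchor : f ≫ Q.anchor = P.anchor
  f_restrict : ∀ ⦃T : E⦄ (x : T ⟶ P.P) (α : T ⟶ C.C₁) (w : x ≫ P.anchor = α ≫ C.cod)
    (w' : (x ≫ f) ≫ Q.anchor = α ≫ C.cod),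
    P.restrict x α w ≫ f = Q.restrict (x ≫ f) α w'

/-- The category `PSh_E(C)` of internal presheaves. -/
instance : Category C.Presheaf where
  Hom := Hom
  id P :=
    { f := 𝟙 _
      f_anchor := by simp
      f_restrict := by intros; simp }
  comp {P Q R} a b :=
    { f := a.f ≫ b.f
      f_anchor := by rw [Category.assoc, b.f_anchor, a.f_anchor]
      f_restrict := by
        intro T x α w w'
        have h : (x ≫ a.f) ≫ Q.anchor = α ≫ C.cod := by
          rw [Category.assoc, a.f_anchor, w]
        have h' : ((x ≫ a.f) ≫ b.f) ≫ R.anchor = α ≫ C.cod := by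
          rw [Category.assoc, b.f_anchor, h]
        rw [← Category.assoc, a.f_restrict x α w h, b.f_restrict (x ≫ a.f) α h h']
        simp only [Category.assoc] }
  id_comp a := Hom.ext (Category.id_comp a.f)
  comp_id a := Hom.ext (Category.comp_id a.f)
  assoc a b c := Hom.ext (Category.assoc a.f b.f c.f)

end Presheaf

end InternalCategory

/-- Sites with underlying internal category `C`: a commutative square of covering families, with
`Cov` the object of covering families, `Ix` the object of pairs of a covering family `U` and an
index `i` of `U`, `φ (U, i) = U`, `m (U, i)` the arrow of `U` with index `i`, and `tgt U` the object
that `U` covers. Axiom (C) is written out in the internal logic: for a covering family `U` and an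
arrow `α` into `tgt U`, both defined on `T`, there is, on an epi `T' ⟶ T`, a covering family `V` of
`dom α` such that for every index `j` of `V` (defined on `s : R ⟶ T'`) there are, on an epi
`R' ⟶ R`, an index `i` of `U` and an arrow `β` with `α ∘ m j = m i ∘ β`. -/
structure Site (C : InternalCategory E) where
  Ix : E
  Cov : E
  m : Ix ⟶ C.C₁
  φ : Ix ⟶ Cov
  tgt : Cov ⟶ C.C₀
  comm : m ≫ C.cod = φ ≫ tgt
  axiomC : ∀ ⦃T : E⦄ (U : T ⟶ Cov) (α : T ⟶ C.C₁), α ≫ C.cod = U ≫ tgt →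
    ∃ (T' : E) (t : T' ⟶ T) (V : T' ⟶ Cov), Epi t ∧ V ≫ tgt = t ≫ α ≫ C.dom ∧
      ∀ ⦃R : E⦄ (s : R ⟶ T') (j : R ⟶ Ix), j ≫ φ = s ≫ V →
        ∃ (R' : E) (r : R' ⟶ R) (i : R' ⟶ Ix) (β : R' ⟶ C.C₁)
          (w₁ : (r ≫ j ≫ m) ≫ C.cod = (r ≫ s ≫ t ≫ α) ≫ C.dom)
          (w₂ : β ≫ C.cod = (i ≫ m) ≫ C.dom),
          Epi r ∧ i ≫ φ = r ≫ s ≫ t ≫ U ∧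
            C.compose (r ≫ j ≫ m) (r ≫ s ≫ t ≫ α) w₁ = C.compose β (i ≫ m) w₂

namespace Site

variable {C : InternalCategory E}

/-- A site has small covers when `φ` is small. -/
def HasSmallCovers (J : Site C) (S : MorphismProperty E) : Prop := S J.φ

/-- A collection site: `(φ, m)` is a collection span over `C₀`. -/
def IsCollectionSite (J : Site C) : Prop :=
  IsCollectionSpanOver J.tgt C.cod J.φ J.m J.comm

/-- For a covering family `U` defined on `T`, a family of elements `x_i` of `P(dom (m i))`, indexed
by the indices `i` of `U`, is a map `x : T ×_Cov Ix ⟶ P` over `C₀`. It is compatible when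
`x_i · α = x_j · β` for all indices `i`, `j` of `U` and all arrows `α`, `β` with
`m i ∘ α = m j ∘ β`. -/
def IsCompatible (J : Site C) (P : C.Presheaf) {T : E} (U : T ⟶ J.Cov)
    (x : pullback U J.φ ⟶ P.P) : Prop :=
  ∀ ⦃R : E⦄ (i j : R ⟶ pullback U J.φ) (α β : R ⟶ C.C₁),
    i ≫ pullback.fst U J.φ = j ≫ pullback.fst U J.φ →
    ∀ (wα : α ≫ C.cod = (i ≫ pullback.snd U J.φ ≫ J.m) ≫ C.dom)
      (wβ : β ≫ C.cod = (j ≫ pullback.snd U J.φ ≫ J.m) ≫ C.dom)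
      (wx : (i ≫ x) ≫ P.anchor = α ≫ C.cod) (wy : (j ≫ x) ≫ P.anchor = β ≫ C.cod),
      C.compose α (i ≫ pullback.snd U J.φ ≫ J.m) wα =
        C.compose β (j ≫ pullback.snd U J.φ ≫ J.m) wβ →
      P.restrict (i ≫ x) α wx = P.restrict (j ≫ x) β wy

/-- The sheaf condition, in the internal logic: for every covering family `U` and every compatible
family `x` there is a unique `z` in `P(tgt U)` with `z · m i = x_i` for all indices `i` of `U`. -/
def IsSheaf (J : Site C) : ObjectProperty C.Presheaf := fun P =>
  ∀ ⦃T : E⦄ (U : T ⟶ J.Cov) (x : pullback U J.φ ⟶ P.P),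
    x ≫ P.anchor = pullback.snd U J.φ ≫ J.m ≫ C.dom →
    J.IsCompatible P U x →
    ∃! z : T ⟶ P.P, z ≫ P.anchor = U ≫ J.tgt ∧
      ∃ w : (pullback.fst U J.φ ≫ z) ≫ P.anchor = (pullback.snd U J.φ ≫ J.m) ≫ C.cod,
        P.restrict (pullback.fst U J.φ ≫ z) (pullback.snd U J.φ ≫ J.m) w = x

/-- The category `Sh_E(C)` of internal sheaves. -/
abbrev Sheaf (J : Site C) := J.IsSheaf.FullSubcategory

/-- Two sites with the same underlying category are equivalent when their categories of internal
sheaves are equivalent, compatibly with the inclusions into presheaves. -/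
def Equivalent (J J' : Site C) : Prop :=
  ∃ e : J.Sheaf ≌ J'.Sheaf, Nonempty (e.functor ⋙ J'.IsSheaf.ι ≅ J.IsSheaf.ι)

end Site

end Internal

end PredTopos

/-!
Given a site `J` with small covers, the collection site is obtained by adding to each covering
family `U` of `J` its reindexings along covers `V_u ⟶ Ix_U`, where `V_u` runs through the fibres of
a universal small map `π : V ⟶ U`. Its covering families form an object `K` of triples `(u, U, e)`
with `e : V_u ⟶ Ix_U` a cover; this object is built from two dependent products, the first of which
classifies maps between the fibres and the second of which cuts out those that are covers
(`exists_coverClassifier`).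

The sheaves do not change (`Site.Reindexing.isSheaf_eq`): by compatibility at identity arrows, a
compatible family on a reindexed covering family takes equal values at two indices that lie over the
same index of `U`, so it descends along the cover `e` to a compatible family on `U`, with the same
amalgamations.

The new covers form a collection span (`isCollectionSpanOver_of_reindexing`): for a cover `F` of the
small index object of a family, the collection axiom gives, locally, a small object `B` with a map
to `F` whose composite to the index object is a cover, and by representability `B` is, locally,
a fibre of `π`, so that `B` is the index object of a further reindexing.

The construction uses the small map `π + φ` in place of `π`. Then every covering family is its own
reindexing globally, by a section of `K ⟶ Cov`, and amalgamations need not be glued along epis.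
-/

namespace PredTopos

/-! ### Covers and quasi-pullbacks in regular categories -/

section Covers

attribute [local simp] pullback.lift_fst pullback.lift_snd pullback.lift_fst_assoc
  pullback.lift_snd_assoc

variable {C : Type u} [Category.{v} C]

theorem isCover_of_isRegularEpi {X Y : C} (f : X ⟶ Y) [IsRegularEpi f] : IsCover f := by
  intro I p i _ h
  exact ExtremalEpi.isIso (f := f) p i h

theorem IsCover.isRegularEpi [Regular C] {X Y : C} {f : X ⟶ Y} (hf : IsCover f) :
    IsRegularEpi f := by
  let F := Regular.strongEpiMonoFactorisation f
  have : IsIso F.m := hf F.e F.m inferInstance F.fac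
  have he : IsRegularEpi F.e :=
    inferInstanceAs (IsRegularEpi (Regular.strongEpiMonoFactorisation f).e)
  exact ⟨⟨RegularEpi.ofArrowIso (Arrow.isoMk (f := .mk F.e) (g := .mk f) (Iso.refl _)
    (asIso F.m) (by simp [F.fac])) (IsRegularEpi.getStruct F.e)⟩⟩

theorem isCover_iff_isRegularEpi [Regular C] {X Y : C} {f : X ⟶ Y} :
    IsCover f ↔ IsRegularEpi f :=
  ⟨fun h => h.isRegularEpi, fun _ => isCover_of_isRegularEpi f⟩

theorem IsCover.epi [Regular C] {X Y : C} {f : X ⟶ Y} (hf : IsCover f) : Epi f :=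
  have := hf.isRegularEpi
  inferInstance

theorem IsCover.comp [Regular C] {X Y Z : C} {f : X ⟶ Y} {g : Y ⟶ Z} (hf : IsCover f)
    (hg : IsCover g) : IsCover (f ≫ g) := by
  have := hf.isRegularEpi
  have := hg.isRegularEpi
  intro I p i _ h
  exact ExtremalEpi.isIso (f := f ≫ g) p i h

theorem isCover_of_isIso {X Y : C} (f : X ⟶ Y) [IsIso f] : IsCover f :=
  isCover_of_isRegularEpi f

theorem IsCover.of_isPullback [Regular C] {P X Y Z : C} {a : P ⟶ X} {b : P ⟶ Y} {f : X ⟶ Z}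
    {g : Y ⟶ Z} (h : IsPullback a b f g) (hf : IsCover f) : IsCover b :=
  isCover_iff_isRegularEpi.2 <|
    Regular.regularEpiIsStableUnderBaseChange.of_isPullback h hf.isRegularEpi

/-- A cover is the quotient of its kernel pair: a map that does not distinguish generalised
elements with the same image descends along it. -/
theorem IsCover.exists_desc [Regular C] {X Y Z : C} {f : X ⟶ Y} (hf : IsCover f) (k : X ⟶ Z)
    (hk : ∀ ⦃R : C⦄ (i j : R ⟶ X), i ≫ f = j ≫ f → i ≫ k = j ≫ k) :
    ∃ d : Y ⟶ Z, f ≫ d = k := by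
  have := hf.isRegularEpi
  exact ⟨IsRegularEpi.desc f k (hk _ _ (IsRegularEpi.w f)), IsRegularEpi.fac f k _⟩

/-- The definition of quasi-pullbacks does not depend on the choice of the pullback. -/
theorem isQuasiPullback_iff_isCover [Regular C] {P Q X Y Z : C} {a : P ⟶ X} {b : P ⟶ Y}
    {f : X ⟶ Z} {g : Y ⟶ Z} (h : IsPullback a b f g) {l : Q ⟶ P} {a' : Q ⟶ X} {b' : Q ⟶ Y}
    (ha : l ≫ a = a') (hb : l ≫ b = b') : IsQuasiPullback a' b' f g ↔ IsCover l := by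
  subst ha hb
  have w : (l ≫ a) ≫ f = (l ≫ b) ≫ g := by simp [h.w]
  have key : pullback.lift (l ≫ a) (l ≫ b) w = l ≫ h.isoPullback.hom := by
    apply pullback.hom_ext <;> simp
  constructor
  · rintro ⟨_, hc⟩
    have : l = pullback.lift (l ≫ a) (l ≫ b) w ≫ h.isoPullback.inv := by simp [key]
    rw [this]
    exact hc.comp (isCover_of_isIso _)
  · intro hl
    exact ⟨w, key ▸ hl.comp (isCover_of_isIso _)⟩

theorem IsQuasiPullback.of_isPullback [Regular C] {P X Y Z : C} {a : P ⟶ X} {b : P ⟶ Y}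
    {f : X ⟶ Z} {g : Y ⟶ Z} (h : IsPullback a b f g) : IsQuasiPullback a b f g :=
  (isQuasiPullback_iff_isCover h (Category.id_comp _) (Category.id_comp _)).2 (isCover_of_isIso _)

/-- Quasi-pullback squares can be pasted. -/
theorem IsQuasiPullback.paste [Regular C] {A B D X Y Z : C} {a : A ⟶ B} {b : B ⟶ D}
    {p : A ⟶ X} {q : B ⟶ Y} {r : D ⟶ Z} {x : X ⟶ Y} {y : Y ⟶ Z}
    (h₁ : IsQuasiPullback a p q x) (h₂ : IsQuasiPullback b q r y) :
    IsQuasiPullback (a ≫ b) p r (x ≫ y) := by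
  obtain ⟨w₁, c₁⟩ := h₁
  obtain ⟨w₂, c₂⟩ := h₂
  -- the comparison map factors through `X ×_Y B`, and `X ×_Y B ⟶ X ×_Z D` is a pullback of
  -- the comparison map of the second square
  have hD : IsPullback (pullback.fst (pullback.snd r y) x ≫ pullback.fst r y)
      (pullback.snd (pullback.snd r y) x) r (x ≫ y) :=
    (IsPullback.of_hasPullback _ _).flip.paste_vert (IsPullback.of_hasPullback r y).flip |>.flip
  have hl : IsPullback (pullback.fst q x)
      (pullback.lift (pullback.fst q x ≫ pullback.lift b q w₂) (pullback.snd q x)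
        (by simp [pullback.condition]))
      (pullback.lift b q w₂) (pullback.fst (pullback.snd r y) x) := by
    refine IsPullback.of_bot ?_ (pullback.lift_fst _ _ _).symm
      (IsPullback.of_hasPullback (pullback.snd r y) x)
    simpa using IsPullback.of_hasPullback q x
  refine (isQuasiPullback_iff_isCover hD (l := pullback.lift a p w₁ ≫
    pullback.lift (pullback.fst q x ≫ pullback.lift b q w₂) (pullback.snd q x)
        (by simp [pullback.condition])) (by simp) (by simp)).2 ?_
  exact c₁.comp (c₂.of_isPullback hl)

/-- A generalised element `(x, y)` of the pullback is, locally, the image of an element of a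
quasi-pullback. -/
theorem IsQuasiPullback.exists_lift [Regular C] {P X Y Z T : C} {a : P ⟶ X} {b : P ⟶ Y}
    {f : X ⟶ Z} {g : Y ⟶ Z} (h : IsQuasiPullback a b f g) (x : T ⟶ X) (y : T ⟶ Y)
    (w : x ≫ f = y ≫ g) :
    ∃ (T' : C) (t : T' ⟶ T) (z : T' ⟶ P), Epi t ∧ z ≫ a = t ≫ x ∧ z ≫ b = t ≫ y := by
  obtain ⟨w', hc⟩ := h
  refine ⟨pullback (pullback.lift a b w') (pullback.lift x y w), pullback.snd _ _,
    pullback.fst _ _, (hc.of_isPullback (IsPullback.of_hasPullback _ _)).epi, ?_, ?_⟩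
  · simpa using pullback.condition (f := pullback.lift a b w') (g := pullback.lift x y w) =≫
      pullback.fst f g
  · simpa using pullback.condition (f := pullback.lift a b w') (g := pullback.lift x y w) =≫
      pullback.snd f g

/-- A square in a slice whose underlying square is a quasi-pullback is a quasi-pullback. -/
theorem IsQuasiPullback.of_left [Regular C] {A : C} {P X Y Z : Over A} {a : P ⟶ X} {b : P ⟶ Y}
    {f : X ⟶ Z} {g : Y ⟶ Z} (h : IsQuasiPullback a.left b.left f.left g.left) :
    IsQuasiPullback a b f g := by
  have w : a ≫ f = b ≫ g := by
    ext
    exact h.choose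
  refine ⟨w, fun I p i _ hpi => ?_⟩
  have hp : IsPullback (pullback.fst f g).left (pullback.snd f g).left f.left g.left :=
    (IsPullback.of_hasPullback f g).map (Over.forget A)
  have hc : IsCover (pullback.lift a b w).left :=
    (isQuasiPullback_iff_isCover hp (by rw [← Over.comp_left, pullback.lift_fst])
      (by rw [← Over.comp_left, pullback.lift_snd])).1 h
  have : IsIso ((Over.forget A).map i) := hc p.left i.left inferInstance (by
    rw [← hpi]; rfl)
  exact isIso_of_reflects_iso i (Over.forget A)

end Covers

/-! ### The object of covers between fibres -/

section Classifier

attribute [local simp] pullback.lift_fst pullback.lift_snd pullback.lift_fst_assoc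
  pullback.lift_snd_assoc prod.lift_fst prod.lift_snd

/-- In a finitary extensive category the summand `f` of `f + g` is the restriction of `f + g` to
the first summand of the codomain. -/
theorem isPullback_inl_map {C : Type u} [Category.{v} C] [FinitaryExtensive C] {X Y X' Y' : C}
    (f : X ⟶ X') (g : Y ⟶ Y') : IsPullback f coprod.inl coprod.inl (coprod.map f g) := by
  exact (((BinaryCofan.isVanKampen_iff _).1 (FinitaryExtensive.vanKampen _ (coprodIsCoprod X' Y'))
    (BinaryCofan.mk (coprod.inl : X ⟶ X ⨿ Y) coprod.inr) f g (coprod.map f g)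
    (coprod.inl_map f g).symm (coprod.inr_map f g).symm).1 ⟨coprodIsCoprod X Y⟩).1.flip

theorem isPullback_inr_map {C : Type u} [Category.{v} C] [FinitaryExtensive C] {X Y X' Y' : C}
    (f : X ⟶ X') (g : Y ⟶ Y') : IsPullback g coprod.inr coprod.inr (coprod.map f g) := by
  exact (((BinaryCofan.isVanKampen_iff _).1 (FinitaryExtensive.vanKampen _ (coprodIsCoprod X' Y'))
    (BinaryCofan.mk (coprod.inl : X ⟶ X ⨿ Y) coprod.inr) f g (coprod.map f g)
    (coprod.inl_map f g).symm (coprod.inr_map f g).symm).1 ⟨coprodIsCoprod X Y⟩).2.flip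

variable {E : Type u} [Category.{v} E] [PiWPretopos E]

/-- The dependent product of `y` along `f` exists, in the form used below: maps into it exist, and
their uniqueness is left out. -/
theorem exists_weakDependentProduct {B A Y : E} (f : B ⟶ A) (y : Y ⟶ B) :
    ∃ (P : E) (p : P ⟶ A) (e : pullback p f ⟶ Y), e ≫ y = pullback.snd p f ∧
      ∀ ⦃Z T : E⦄ (z : Z ⟶ A) (t : T ⟶ Z) (c : T ⟶ B), IsPullback t c z f →
        ∀ h : T ⟶ Y, h ≫ y = c → ∃ g : Z ⟶ P, g ≫ p = z ∧
          ∀ k : T ⟶ pullback p f, k ≫ pullback.fst p f = t ≫ g → k ≫ pullback.snd p f = c →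
            k ≫ e = h := by
  have := LocallyCartesianClosed.isLeftAdjoint f
  let adj := Adjunction.ofIsLeftAdjoint (Over.pullback f)
  let P := (Over.pullback f).rightAdjoint.obj (Over.mk y)
  refine ⟨P.left, P.hom, (adj.counit.app (Over.mk y)).left, Over.w (adj.counit.app (Over.mk y)),
    fun Z T z t c hT h hy => ?_⟩
  let k₀ : (Over.pullback f).obj (Over.mk z) ⟶ Over.mk y :=
    Over.homMk (hT.isoPullback.inv ≫ h) (by simp [hy])
  let g := adj.homEquiv _ _ k₀
  have hg : (Over.pullback f).map g ≫ adj.counit.app (Over.mk y) = k₀ := by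
    exact (adj.homEquiv_counit ..).symm.trans ((adj.homEquiv _ _).symm_apply_apply k₀)
  refine ⟨g.left, Over.w g, fun k hk₁ hk₂ => ?_⟩
  have hk : k = hT.isoPullback.hom ≫ ((Over.pullback f).map g).left := by
    apply pullback.hom_ext
    · have : ((Over.pullback f).map g).left ≫ pullback.fst P.hom f = pullback.fst z f ≫ g.left :=
        pullback.lift_fst _ _ _
      rw [hk₁, Category.assoc, this, hT.isoPullback_hom_fst_assoc]
    · have : ((Over.pullback f).map g).left ≫ pullback.snd P.hom f = pullback.snd z f :=
        pullback.lift_snd _ _ _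
      rw [hk₂, Category.assoc, this, hT.isoPullback_hom_snd]
  have := congrArg (fun m => hT.isoPullback.hom ≫ m.left) hg
  simpa [hk, k₀] using this

/-- For `l : Q ⟶ D` over `P`, by way of `d : D ⟶ P`, there is a universal `i : K ⟶ P` such that the
pullback of `l` along `i` is a cover: it is the universal quantification along `d` of the image
of `l`. -/
theorem exists_coverLocus {Q D P : E} (l : Q ⟶ D) (d : D ⟶ P) :
    ∃ (K : E) (i : K ⟶ P),
      (∀ ⦃Q' D' : E⦄ (b : Q' ⟶ Q) (l' : Q' ⟶ D') (a : D' ⟶ D) (d' : D' ⟶ K),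
        IsPullback d' a i d → IsPullback b l' l a → IsCover l') ∧
      ∀ ⦃T Q' D' : E⦄ (z : T ⟶ P) (b : Q' ⟶ Q) (l' : Q' ⟶ D') (a : D' ⟶ D) (d' : D' ⟶ T),
        IsPullback d' a z d → b ≫ l = l' ≫ a → IsCover l' → ∃ g : T ⟶ K, g ≫ i = z := by
  let F := Regular.strongEpiMonoFactorisation l
  have he : IsRegularEpi F.e :=
    inferInstanceAs (IsRegularEpi (Regular.strongEpiMonoFactorisation l).e)
  obtain ⟨K, i, ε, hε, hK⟩ := exists_weakDependentProduct d F.m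
  refine ⟨K, i, fun Q' D' b l' a d' hD hQ => ?_, fun T Q' D' z b l' a d' hD w hl' => ?_⟩
  · have hs : (pullback.lift d' a hD.w ≫ ε) ≫ F.m = a := by simp [hε]
    have hsq : IsPullback b l' F.e (pullback.lift d' a hD.w ≫ ε) := by
      refine ⟨⟨?_⟩, ⟨PullbackCone.IsLimit.mk _
        (fun s => hQ.lift s.fst s.snd ?_) ?_ ?_ ?_⟩⟩
      · rw [← cancel_mono F.m, Category.assoc, Category.assoc, hs, F.fac, hQ.w]
      · simpa [hs] using s.condition =≫ F.m
      · intro s; simp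
      · intro s; simp
      · intro s m h₁ h₂; apply hQ.hom_ext <;> simp [h₁, h₂]
    exact (isCover_of_isRegularEpi F.e).of_isPullback hsq
  · have := hl'.isRegularEpi
    have sq : CommSq (b ≫ F.e) l' F.m a := ⟨by rw [Category.assoc, F.fac, w]⟩
    obtain ⟨g, hg, -⟩ := hK z d' a hD sq.lift sq.fac_right
    exact ⟨g, hg⟩

/-- The object of triples of `u` in `U`, `k` in `N` and a cover `V_u ⟶ I_k` between the fibres
of `ρ` and `φ`. It comes with the universal such cover `e`, and every family of such covers is a
pullback of it. -/
theorem exists_coverClassifier {V U I N : E} (ρ : V ⟶ U) (φ : I ⟶ N) :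
    ∃ (K Q : E) (u : K ⟶ U) (k : K ⟶ N) (q : Q ⟶ K) (c : Q ⟶ V) (e : Q ⟶ I),
      IsPullback q c u ρ ∧ IsQuasiPullback e q φ k ∧
      ∀ ⦃T Q' : E⦄ (u' : T ⟶ U) (k' : T ⟶ N) (q' : Q' ⟶ T) (c' : Q' ⟶ V) (e' : Q' ⟶ I),
        IsPullback q' c' u' ρ → IsQuasiPullback e' q' φ k' →
        ∃ (g : T ⟶ K) (a : Q' ⟶ Q), IsPullback a q' q g ∧ g ≫ k = k' ∧ a ≫ e = e' := by
  -- `P` is the object of triples `(u, k, t)` with `t : V_u ⟶ I_k` an arbitrary map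
  let f : pullback (prod.fst : U ⨯ N ⟶ U) ρ ⟶ U ⨯ N := pullback.fst _ _
  obtain ⟨P, p, e₁, he₁, hP⟩ :=
    exists_weakDependentProduct f (pullback.snd φ (f ≫ prod.snd))
  let kP : P ⟶ N := p ≫ prod.snd
  let qP : pullback p f ⟶ P := pullback.fst p f
  let eP : pullback p f ⟶ I := e₁ ≫ pullback.fst _ _
  have hqP : IsPullback qP (pullback.snd p f ≫ pullback.snd _ _) (p ≫ prod.fst) ρ :=
    (IsPullback.of_hasPullback p f).flip.paste_horiz
      (IsPullback.of_hasPullback (prod.fst : U ⨯ N ⟶ U) ρ).flip |>.flip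
  have heP : eP ≫ φ = qP ≫ kP := by
    simp only [eP, qP, kP, Category.assoc, pullback.condition, pullback.condition_assoc]
    rw [reassoc_of% he₁]
  let l : pullback p f ⟶ pullback φ kP := pullback.lift eP qP heP
  -- `K` is the locus where `t` is a cover
  obtain ⟨K, i, hK₁, hK₂⟩ := exists_coverLocus l (pullback.snd φ kP)
  -- the comparison maps of the pulled back squares are pullbacks of `l`
  have hbase : ∀ ⦃T Q' : E⦄ (z : T ⟶ P) (a : Q' ⟶ pullback p f) (q' : Q' ⟶ T),
      IsPullback a q' qP z → ∃ (D' : E) (l' : Q' ⟶ D') (b : D' ⟶ pullback φ kP) (d' : D' ⟶ T),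
        IsPullback d' b z (pullback.snd φ kP) ∧ IsPullback a l' l b ∧
        (IsQuasiPullback (a ≫ eP) q' φ (z ≫ kP) ↔ IsCover l') := by
    intro T Q' z a q' ha
    have hD := IsPullback.of_hasPullback z (pullback.snd φ kP)
    have w : q' ≫ z = (a ≫ l) ≫ pullback.snd φ kP := by simp [l, ha.w]
    refine ⟨_, hD.lift q' (a ≫ l) w, _, _, hD, ?_, ?_⟩
    · refine IsPullback.of_bot ?_ (hD.lift_snd _ _ w).symm hD.flip
      simpa [l] using ha
    · exact isQuasiPullback_iff_isCover
        (hD.paste_vert (IsPullback.of_hasPullback φ kP).flip).flip (by simp [l]) (by simp)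
  have hQ := IsPullback.of_hasPullback qP i
  obtain ⟨D', l', b, d', hD', hl', hiff⟩ := hbase i _ _ hQ
  refine ⟨K, pullback qP i, i ≫ p ≫ prod.fst, i ≫ kP, pullback.snd _ _,
    pullback.fst _ _ ≫ pullback.snd p f ≫ pullback.snd _ _, pullback.fst _ _ ≫ eP,
    hQ.paste_horiz hqP.flip |>.flip, hiff.2 (hK₁ _ _ _ _ hD' hl'), ?_⟩
  intro T Q' u' k' q' c' e' hc he
  have we : e' ≫ φ = q' ≫ k' := he.choose
  have hcB : IsPullback q' (pullback.lift (q' ≫ prod.lift u' k') c' (by simp [hc.w]))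
      (prod.lift u' k') f := by
    refine IsPullback.of_right ?_ (by simp)
      (IsPullback.of_hasPullback (prod.fst : U ⨯ N ⟶ U) ρ).flip |>.flip
    simpa using hc.flip
  obtain ⟨g₁, hg₁, hk⟩ := hP _ _ _ hcB (pullback.lift e' (pullback.lift _ _ _)
    (by simp [f, we])) (pullback.lift_snd _ _ _)
  have hgk : g₁ ≫ kP = k' := by simp [kP, reassoc_of% hg₁]
  have wk : (q' ≫ g₁) ≫ p = pullback.lift (q' ≫ prod.lift u' k') c' (by simp [hc.w]) ≫ f := by
    simp [f, hg₁]
  have ha : IsPullback (pullback.lift (q' ≫ g₁) _ wk) q' qP g₁ := by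
    refine IsPullback.of_right ?_ (pullback.lift_fst _ _ wk) (IsPullback.of_hasPullback p f).flip
    simpa [hg₁] using hcB.flip
  have hae : pullback.lift (q' ≫ g₁) _ wk ≫ eP = e' := by
    rw [← Category.assoc, hk _ (by simp) (by simp), pullback.lift_fst]
  obtain ⟨D₁, l₁, b₁, d₁, hD₁, hl₁, hiff₁⟩ := hbase _ _ _ ha
  rw [hae, hgk] at hiff₁
  obtain ⟨g, hg⟩ := hK₂ _ _ _ _ _ hD₁ hl₁.w (hiff₁.1 he)
  refine ⟨g, hQ.lift (pullback.lift (q' ≫ g₁) _ wk) (q' ≫ g) (by simp [qP, hg]), ?_, ?_, ?_⟩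
  · refine IsPullback.of_right ?_ (hQ.lift_snd _ _ _) hQ
    simpa [hg] using ha
  · rw [← hgk, ← hg, Category.assoc]
  · rw [hQ.lift_fst_assoc, hae]

end Classifier

/-! ### Refining the covering families of a site -/

section Refine

attribute [local simp] pullback.lift_fst pullback.lift_snd pullback.lift_fst_assoc
  pullback.lift_snd_assoc

variable {E : Type u} [Category.{v} E]

namespace InternalCategory

variable [HasPullbacks E] {C : InternalCategory E}

theorem compose_congr {T : E} {α α' β β' : T ⟶ C.C₁} (hα : α = α') (hβ : β = β')
    (w : α ≫ C.cod = β ≫ C.dom) (w' : α' ≫ C.cod = β' ≫ C.dom) :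
    C.compose α β w = C.compose α' β' w' := by
  subst hα hβ
  rfl

theorem comp_compose {T R : E} (r : R ⟶ T) {α β : T ⟶ C.C₁} (w : α ≫ C.cod = β ≫ C.dom)
    (w' : (r ≫ α) ≫ C.cod = (r ≫ β) ≫ C.dom) :
    r ≫ C.compose α β w = C.compose (r ≫ α) (r ≫ β) w' := by
  rw [compose, compose, ← Category.assoc]
  congr 1
  apply pullback.hom_ext <;> simp

namespace Presheaf

variable (P : C.Presheaf)

theorem restrict_congr {T : E} {x x' : T ⟶ P.P} {α α' : T ⟶ C.C₁} (hx : x = x') (hα : α = α')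
    (w : x ≫ P.anchor = α ≫ C.cod) (w' : x' ≫ P.anchor = α' ≫ C.cod) :
    P.restrict x α w = P.restrict x' α' w' := by
  subst hx hα
  rfl

theorem comp_restrict {T R : E} (r : R ⟶ T) {x : T ⟶ P.P} {α : T ⟶ C.C₁}
    (w : x ≫ P.anchor = α ≫ C.cod) (w' : (r ≫ x) ≫ P.anchor = (r ≫ α) ≫ C.cod) :
    r ≫ P.restrict x α w = P.restrict (r ≫ x) (r ≫ α) w' := by
  rw [restrict, restrict, ← Category.assoc]
  congr 1
  apply pullback.hom_ext <;> simp

theorem restrict_id {T : E} (x : T ⟶ P.P) {α : T ⟶ C.C₁} (hα : x ≫ P.anchor ≫ C.id = α)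
    (w : x ≫ P.anchor = α ≫ C.cod) : P.restrict x α w = x := by
  subst hα
  exact P.act_id x w

end Presheaf

end InternalCategory

namespace Site

variable [Regular E] {C : InternalCategory E} (J : Site C)

/-- The element `z` of `P (tgt U)` amalgamates the family `x` on the covering family `U`. -/
def IsAmalgamation (P : C.Presheaf) {T : E} (U : T ⟶ J.Cov) (x : pullback U J.φ ⟶ P.P)
    (z : T ⟶ P.P) : Prop :=
  z ≫ P.anchor = U ≫ J.tgt ∧
    ∃ w : (pullback.fst U J.φ ≫ z) ≫ P.anchor = (pullback.snd U J.φ ≫ J.m) ≫ C.cod,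
      P.restrict (pullback.fst U J.φ ≫ z) (pullback.snd U J.φ ≫ J.m) w = x

/-- The sheaf condition of `P` for the covering family `U`. -/
def IsSheafFor (P : C.Presheaf) {T : E} (U : T ⟶ J.Cov) : Prop :=
  ∀ x : pullback U J.φ ⟶ P.P, x ≫ P.anchor = pullback.snd U J.φ ≫ J.m ≫ C.dom →
    J.IsCompatible P U x → ∃! z : T ⟶ P.P, J.IsAmalgamation P U x z

variable {K Q : E} (κ : K ⟶ J.Cov) (q : Q ⟶ K) (e : Q ⟶ J.Ix) (s : J.Cov ⟶ K)

/-- The site whose covering families are reindexings of those of `J`: the family named by `k` in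
`K` is the family `κ k` of `J`, reindexed along the cover `e : Q_k ⟶ Ix_(κ k)`. The section `s`
says that every covering family of `J` has a chosen reindexing, so that axiom (C) is inherited. -/
def reindex (h : IsQuasiPullback e q J.φ κ) (hs : s ≫ κ = 𝟙 _) : Site C where
  Ix := Q
  Cov := K
  m := e ≫ J.m
  φ := q
  tgt := κ ≫ J.tgt
  comm := by rw [Category.assoc, J.comm, reassoc_of% h.choose]
  axiomC := by
    intro T U α hα
    obtain ⟨T', t, V, ht, hV, hfac⟩ := J.axiomC (U ≫ κ) α (by rw [hα, Category.assoc])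
    refine ⟨T', t, V ≫ s, ht, by simp [reassoc_of% hs, hV], fun R p j hj => ?_⟩
    have hj' : (j ≫ e) ≫ J.φ = p ≫ V := by
      rw [Category.assoc, h.choose, reassoc_of% hj, hs, Category.comp_id]
    obtain ⟨R', r, i, β, w₁, w₂, hr, hi, hc⟩ := hfac p (j ≫ e) hj'
    -- the index `i` of the family of `J` lifts, locally, to an index of its reindexing
    obtain ⟨R'', r', i', hr', hi₁, hi₂⟩ := h.exists_lift i (r ≫ p ≫ t ≫ U) (by simp [hi])
    have a₁ : (r' ≫ r) ≫ j ≫ e ≫ J.m = r' ≫ r ≫ (j ≫ e) ≫ J.m := by simp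
    have a₂ : (r' ≫ r) ≫ p ≫ t ≫ α = r' ≫ r ≫ p ≫ t ≫ α := by simp
    have a₃ : i' ≫ e ≫ J.m = r' ≫ i ≫ J.m := by rw [reassoc_of% hi₁]
    have v₁ : (r' ≫ r ≫ (j ≫ e) ≫ J.m) ≫ C.cod = (r' ≫ r ≫ p ≫ t ≫ α) ≫ C.dom := by
      simpa using r' ≫= w₁
    have v₂ : (r' ≫ β) ≫ C.cod = (r' ≫ i ≫ J.m) ≫ C.dom := by simpa using r' ≫= w₂
    refine ⟨R'', r' ≫ r, i', r' ≫ β, by rw [a₁, a₂, v₁], by rw [a₃, v₂],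
      epi_comp _ _, by simp [hi₂], ?_⟩
    rw [InternalCategory.compose_congr a₁ a₂ _ v₁, InternalCategory.compose_congr rfl a₃ _ v₂,
      ← InternalCategory.comp_compose r' w₁, hc, InternalCategory.comp_compose]

/-- The covering families of `J'` are reindexings, along covers, of covering families of `J`, and
every covering family of `J` has a chosen reindexing in `J'`. -/
structure Reindexing (J' J : Site C) where
  /-- The family of `J` that a family of `J'` reindexes. -/
  κ : J'.Cov ⟶ J.Cov
  /-- The map that sends an index of a family of `J'` to the index of `J` that it stands for. -/
  e : J'.Ix ⟶ J.Ix
  /-- The chosen reindexing of a family of `J`. -/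
  s : J.Cov ⟶ J'.Cov
  isQuasiPullback : IsQuasiPullback e J'.φ J.φ κ
  m_eq : J'.m = e ≫ J.m
  tgt_eq : J'.tgt = κ ≫ J.tgt
  s_κ : s ≫ κ = 𝟙 _

/-- The covering families of `J.reindex` are reindexings of those of `J`. -/
def reindexing (h : IsQuasiPullback e q J.φ κ) (hs : s ≫ κ = 𝟙 _) :
    Reindexing (J.reindex κ q e s h hs) J where
  κ := κ
  e := e
  s := s
  isQuasiPullback := h
  m_eq := rfl
  tgt_eq := rfl
  s_κ := hs

namespace Reindexing

variable {J J' : Site C} (h : Reindexing J' J)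

/-- The map from the indices of a covering family of `J'` to those of the covering family of `J`
that it reindexes. -/
noncomputable def indexMap {T : E} (U : T ⟶ J'.Cov) : pullback U J'.φ ⟶ pullback (U ≫ h.κ) J.φ :=
  pullback.lift (pullback.fst U J'.φ) (pullback.snd U J'.φ ≫ h.e)
    (by rw [Category.assoc, h.isQuasiPullback.choose, pullback.condition_assoc])

theorem indexMap_fst {T : E} (U : T ⟶ J'.Cov) :
    h.indexMap U ≫ pullback.fst (U ≫ h.κ) J.φ = pullback.fst U J'.φ :=
  pullback.lift_fst _ _ _

theorem indexMap_snd {T : E} (U : T ⟶ J'.Cov) :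
    h.indexMap U ≫ pullback.snd (U ≫ h.κ) J.φ = pullback.snd U J'.φ ≫ h.e :=
  pullback.lift_snd _ _ _

theorem indexMap_snd_m {T : E} (U : T ⟶ J'.Cov) :
    h.indexMap U ≫ pullback.snd (U ≫ h.κ) J.φ ≫ J.m = pullback.snd U J'.φ ≫ J'.m := by
  rw [← Category.assoc, indexMap_snd, Category.assoc, h.m_eq]

theorem isCover_indexMap {T : E} (U : T ⟶ J'.Cov) : IsCover (h.indexMap U) :=
  (isQuasiPullback_iff_isCover (IsPullback.of_hasPullback (U ≫ h.κ) J.φ).flip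
    (h.indexMap_snd U) (h.indexMap_fst U)).1
    ((IsQuasiPullback.of_isPullback (IsPullback.of_hasPullback U J'.φ).flip).paste
      h.isQuasiPullback)

variable (P : C.Presheaf) {T : E} (U : T ⟶ J'.Cov)

theorem isAmalgamation_iff (x : pullback (U ≫ h.κ) J.φ ⟶ P.P) (z : T ⟶ P.P) :
    J'.IsAmalgamation P U (h.indexMap U ≫ x) z ↔
      J.IsAmalgamation P (U ≫ h.κ) x z := by
  have := (h.isCover_indexMap U).epi
  have hf : h.indexMap U ≫ pullback.fst (U ≫ h.κ) J.φ ≫ z = pullback.fst U J'.φ ≫ z := by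
    rw [← Category.assoc, indexMap_fst]
  have hm := h.indexMap_snd_m U
  have hanchor : z ≫ P.anchor = U ≫ J'.tgt ↔ z ≫ P.anchor = (U ≫ h.κ) ≫ J.tgt := by
    rw [h.tgt_eq, Category.assoc]
  refine and_congr hanchor ⟨fun ⟨w, hw⟩ => ?_, fun ⟨w, hw⟩ => ?_⟩
  · have w' : (pullback.fst (U ≫ h.κ) J.φ ≫ z) ≫ P.anchor =
        (pullback.snd (U ≫ h.κ) J.φ ≫ J.m) ≫ C.cod := by
      rw [← cancel_epi (h.indexMap U), ← Category.assoc, hf, ← Category.assoc, hm]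
      exact w
    refine ⟨w', ?_⟩
    rw [← cancel_epi (h.indexMap U), ← hw,
      P.comp_restrict (h.indexMap U) w'
        (by rw [Category.assoc _ _ P.anchor, w', Category.assoc (h.indexMap U)])]
    exact P.restrict_congr hf hm _ _
  · have w' : (pullback.fst U J'.φ ≫ z) ≫ P.anchor = (pullback.snd U J'.φ ≫ J'.m) ≫ C.cod := by
      rw [← hf, ← hm, Category.assoc _ _ P.anchor, w, Category.assoc (h.indexMap U)]
    refine ⟨w', ?_⟩
    rw [← hw, P.comp_restrict (h.indexMap U) w
      (by rw [Category.assoc _ _ P.anchor, w, Category.assoc (h.indexMap U)])]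
    exact P.restrict_congr hf.symm hm.symm _ _

theorem isCompatible_iff (x : pullback (U ≫ h.κ) J.φ ⟶ P.P) :
    J'.IsCompatible P U (h.indexMap U ≫ x) ↔
      J.IsCompatible P (U ≫ h.κ) x := by
  have hl := h.isCover_indexMap U
  have hm := h.indexMap_snd_m U
  constructor
  · intro H R i j α β hij wα wβ wx wy hc
    -- locally, both indices lift to the reindexed family
    have hP₁ := IsPullback.of_hasPullback (h.indexMap U) i
    have hP₂ := IsPullback.of_hasPullback (h.indexMap U) (pullback.snd (h.indexMap U) i ≫ j)
    let r := pullback.snd (h.indexMap U) (pullback.snd (h.indexMap U) i ≫ j) ≫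
      pullback.snd (h.indexMap U) i
    let i' := pullback.snd (h.indexMap U) (pullback.snd (h.indexMap U) i ≫ j) ≫
      pullback.fst (h.indexMap U) i
    let j' := pullback.fst (h.indexMap U) (pullback.snd (h.indexMap U) i ≫ j)
    have hr : Epi r := ((hl.of_isPullback hP₂).comp (hl.of_isPullback hP₁)).epi
    have hi : i' ≫ h.indexMap U = r ≫ i := by simp only [i', r, Category.assoc, hP₁.w]
    have hj : j' ≫ h.indexMap U = r ≫ j := by simp only [j', r, Category.assoc, hP₂.w]
    have hix : i' ≫ h.indexMap U ≫ x = r ≫ i ≫ x := by rw [reassoc_of% hi]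
    have hjx : j' ≫ h.indexMap U ≫ x = r ≫ j ≫ x := by rw [reassoc_of% hj]
    have him : i' ≫ pullback.snd U J'.φ ≫ J'.m = r ≫ i ≫ pullback.snd _ _ ≫ J.m := by
      rw [← hm, reassoc_of% hi]
    have hjm : j' ≫ pullback.snd U J'.φ ≫ J'.m = r ≫ j ≫ pullback.snd _ _ ≫ J.m := by
      rw [← hm, reassoc_of% hj]
    have vα : (r ≫ α) ≫ C.cod = (r ≫ i ≫ pullback.snd (U ≫ h.κ) J.φ ≫ J.m) ≫ C.dom := by
      rw [Category.assoc r, wα, Category.assoc r]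
    have vβ : (r ≫ β) ≫ C.cod = (r ≫ j ≫ pullback.snd (U ≫ h.κ) J.φ ≫ J.m) ≫ C.dom := by
      rw [Category.assoc r, wβ, Category.assoc r]
    have vx : (r ≫ i ≫ x) ≫ P.anchor = (r ≫ α) ≫ C.cod := by
      rw [Category.assoc r, wx, Category.assoc r]
    have vy : (r ≫ j ≫ x) ≫ P.anchor = (r ≫ β) ≫ C.cod := by
      rw [Category.assoc r, wy, Category.assoc r]
    rw [← cancel_epi r, P.comp_restrict r wx vx, P.comp_restrict r wy vy]
    refine (P.restrict_congr hix.symm rfl _ (by rw [hix, vx])).trans (Eq.trans ?_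
      (P.restrict_congr hjx rfl (by rw [hjx, vy]) _))
    refine H i' j' (r ≫ α) (r ≫ β) ?_ (vα.trans (by rw [← him]))
      (vβ.trans (by rw [← hjm])) _ _ ?_
    · rw [← h.indexMap_fst U, reassoc_of% hi, reassoc_of% hj, hij]
    · refine (InternalCategory.compose_congr rfl him _ vα).trans
        (Eq.trans ?_ (InternalCategory.compose_congr rfl hjm.symm vβ _))
      rw [← InternalCategory.comp_compose r wα, ← InternalCategory.comp_compose r wβ, hc]
  · intro H R i j α β hij wα wβ wx wy hc
    have him : i ≫ pullback.snd U J'.φ ≫ J'.m =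
        (i ≫ h.indexMap U) ≫ pullback.snd _ _ ≫ J.m := by
      rw [← hm, Category.assoc]
    have hjm : j ≫ pullback.snd U J'.φ ≫ J'.m =
        (j ≫ h.indexMap U) ≫ pullback.snd _ _ ≫ J.m := by
      rw [← hm, Category.assoc]
    have hi : i ≫ h.indexMap U ≫ x = (i ≫ h.indexMap U) ≫ x := (Category.assoc ..).symm
    have hj : j ≫ h.indexMap U ≫ x = (j ≫ h.indexMap U) ≫ x := (Category.assoc ..).symm
    refine (P.restrict_congr hi rfl _ (by rw [← hi, wx])).trans (Eq.trans ?_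
      (P.restrict_congr hj.symm rfl (by rw [← hj, wy]) _))
    refine H (i ≫ h.indexMap U) (j ≫ h.indexMap U) α β ?_ (by rw [← him]; exact wα)
      (by rw [← hjm]; exact wβ) _ _ ?_
    · rw [Category.assoc, Category.assoc, indexMap_fst]
      exact hij
    · exact (InternalCategory.compose_congr rfl him.symm _ _).trans
        (hc.trans (InternalCategory.compose_congr rfl hjm _ _))

/-- A compatible family on a reindexed covering family takes equal values at indices over the same
index of `J`, so it comes from a family on the underlying covering family of `J`. -/
theorem exists_indexMap_comp {x : pullback U J'.φ ⟶ P.P}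
    (hx : x ≫ P.anchor = pullback.snd U J'.φ ≫ J'.m ≫ C.dom)
    (hc : J'.IsCompatible P U x) :
    ∃ y : pullback (U ≫ h.κ) J.φ ⟶ P.P, h.indexMap U ≫ y = x := by
  refine (h.isCover_indexMap U).exists_desc x fun R i j hij => ?_
  have h₁ : i ≫ pullback.fst U J'.φ = j ≫ pullback.fst U J'.φ := by
    rw [← h.indexMap_fst U, reassoc_of% hij]
  have hm := h.indexMap_snd_m U
  have h₂ : i ≫ pullback.snd U J'.φ ≫ J'.m = j ≫ pullback.snd U J'.φ ≫ J'.m := by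
    have := hij =≫ (pullback.snd (U ≫ h.κ) J.φ ≫ J.m)
    simpa only [Category.assoc, hm] using this
  have hi : (i ≫ x) ≫ P.anchor = (i ≫ pullback.snd U J'.φ ≫ J'.m) ≫ C.dom := by
    simp [hx]
  have hj : (j ≫ x) ≫ P.anchor = (i ≫ pullback.snd U J'.φ ≫ J'.m) ≫ C.dom := by
    rw [h₂]; simp [hx]
  -- compatibility at identity arrows
  have wα : ((i ≫ x) ≫ P.anchor ≫ C.id) ≫ C.cod =
      (i ≫ pullback.snd U J'.φ ≫ J'.m) ≫ C.dom := by
    rw [← hi]; simp [C.id_cod]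
  have wβ : ((i ≫ x) ≫ P.anchor ≫ C.id) ≫ C.cod =
      (j ≫ pullback.snd U J'.φ ≫ J'.m) ≫ C.dom := by
    rw [wα, h₂]
  have := hc i j ((i ≫ x) ≫ P.anchor ≫ C.id) ((i ≫ x) ≫ P.anchor ≫ C.id) h₁ wα wβ
    (by rw [wα, hi]) (by rw [wα, hj]) (InternalCategory.compose_congr rfl h₂ _ _)
  rwa [P.restrict_id _ rfl, P.restrict_id _ (by rw [← Category.assoc, hj, ← hi, Category.assoc])]
    at this

theorem isSheafFor_iff :
    J'.IsSheafFor P U ↔ J.IsSheafFor P (U ≫ h.κ) := by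
  have := (h.isCover_indexMap U).epi
  have hanchor : ∀ x : pullback (U ≫ h.κ) J.φ ⟶ P.P,
      (h.indexMap U ≫ x) ≫ P.anchor = pullback.snd U J'.φ ≫ J'.m ≫ C.dom ↔
        x ≫ P.anchor = pullback.snd (U ≫ h.κ) J.φ ≫ J.m ≫ C.dom := by
    intro x
    rw [← cancel_epi (h.indexMap U), ← Category.assoc (h.indexMap U) (pullback.snd _ _),
      indexMap_snd, h.m_eq]
    simp only [Category.assoc]
  constructor
  · intro H x hx hc
    obtain ⟨z, hz, huniq⟩ := H (h.indexMap U ≫ x) ((hanchor x).2 hx)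
      ((h.isCompatible_iff P U x).2 hc)
    exact ⟨z, (h.isAmalgamation_iff P U x z).1 hz,
      fun z' hz' => huniq z' ((h.isAmalgamation_iff P U x z').2 hz')⟩
  · intro H x' hx' hc'
    obtain ⟨x, rfl⟩ := h.exists_indexMap_comp P U hx' hc'
    obtain ⟨z, hz, huniq⟩ := H x ((hanchor x).1 hx') ((h.isCompatible_iff P U x).1 hc')
    exact ⟨z, (h.isAmalgamation_iff P U x z).2 hz,
      fun z' hz' => huniq z' ((h.isAmalgamation_iff P U x z').1 hz')⟩

theorem isSheaf_eq (h : Reindexing J' J) : J'.IsSheaf = J.IsSheaf := by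
  ext P
  constructor
  · intro H T U
    have := (h.isSheafFor_iff P (U ≫ h.s)).1 (H (U ≫ h.s))
    rw [Category.assoc, h.s_κ, Category.comp_id] at this
    exact this
  · intro H T U
    exact (h.isSheafFor_iff P U).2 (H (U ≫ h.κ))

end Reindexing

theorem Equivalent.of_isSheaf_eq {J J' : Site C} (h : J.IsSheaf = J'.IsSheaf) : J.Equivalent J' :=
  ⟨ObjectProperty.fullSubcategoryCongr h, ⟨Iso.refl _⟩⟩

end Site

end Refine

/-! ### Collection spans -/

section Collection

variable {E : Type u} [Category.{v} E]

/-- Let the fibres of `q` over `K` be reindexings, along covers `e`, of fibres of `φ`. If every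
reindexing of a fibre of `φ` by a small object is, locally, a fibre of `q`, then collection makes
`q` with any map defined on the indices of `φ` a collection span: for a cover `F ⟶ Q_k`, collection
gives a small object with a map to `F` and a cover of `Q_k`, and hence of the fibre of `φ` that
`Q_k` reindexes; this small object is a fibre of `q`. -/
theorem isCollectionSpanOver_of_reindexing [Regular E] [HasFiniteCoproducts E]
    {S : MorphismProperty E} (hS : IsStableClass S) (hCA : SatisfiesCollection S)
    {I N K Q : E} {φ : I ⟶ N} {k : K ⟶ N} {q : Q ⟶ K} {e : Q ⟶ I} (hq : S q)
    (hqp : IsQuasiPullback e q φ k)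
    (hK : ∀ ⦃B A : E⦄ (g : B ⟶ A) (k' : A ⟶ N) (e' : B ⟶ I), S g → IsQuasiPullback e' g φ k' →
      ∃ (B' A' : E) (p : A' ⟶ A) (b : B' ⟶ B) (g' : B' ⟶ A') (z : A' ⟶ K) (a : B' ⟶ Q),
        Epi p ∧ IsPullback b g' g p ∧ IsPullback a g' q z ∧ z ≫ k = p ≫ k' ∧ a ≫ e = b ≫ e')
    {A M : E} (τ : N ⟶ A) (β : M ⟶ A) (m : I ⟶ M) (w : (e ≫ m) ≫ β = q ≫ k ≫ τ) :
    IsCollectionSpanOver (k ≫ τ) β q (e ≫ m) w := by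
  intro T F c f hf
  let γ : Over.mk (q ≫ k ≫ τ) ⟶ Over.mk (k ≫ τ) := Over.homMk q rfl
  have hf' : Epi f.left := inferInstanceAs (Epi ((Over.forget A).map f))
  let d₁ := (pullback.fst c γ).left
  let d₂ := (pullback.snd c γ).left
  have hD : IsPullback d₁ d₂ c.left q := (IsPullback.of_hasPullback c γ).map (Over.forget A)
  obtain ⟨B, Y, g, b, y, hg, hy, hB⟩ :=
    hCA d₁ f.left (hS.pullback _ _ _ _ hD.flip hq) hf'
  obtain ⟨B', A', p, b', g', z, a, hp, hb', ha, hz, hae⟩ :=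
    hK g _ _ hg (hB.paste ((IsQuasiPullback.of_isPullback hD.flip).paste hqp))
  have hzT : z ≫ k ≫ τ = (p ≫ y) ≫ T.hom := by
    have hc : c.left ≫ k ≫ τ = T.hom := Over.w c
    rw [reassoc_of% hz, hc, Category.assoc]
  let T' : Over A := Over.mk ((p ≫ y) ≫ T.hom)
  let z' : T' ⟶ Over.mk (k ≫ τ) := Over.homMk z hzT
  have hD' : IsPullback (pullback.snd z' γ).left (pullback.fst z' γ).left q z :=
    ((IsPullback.of_hasPullback z' γ).map (Over.forget A)).flip
  let θ := (hD'.isoIsPullback _ _ ha).hom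
  have hθa : θ ≫ a = (pullback.snd z' γ).left := hD'.isoIsPullback_hom_fst _ _ ha
  have hθg : θ ≫ g' = (pullback.fst z' γ).left := hD'.isoIsPullback_hom_snd _ _ ha
  have hθ : IsQuasiPullback (θ ≫ b' ≫ b ≫ f.left) (pullback.fst z' γ).left d₁ (p ≫ y) := by
    have := (IsQuasiPullback.of_isPullback (IsPullback.of_horiz_isIso
      ⟨show θ ≫ g' = (pullback.fst z' γ).left ≫ 𝟙 _ by rw [hθg, Category.comp_id]⟩)).paste
      ((IsQuasiPullback.of_isPullback hb').paste hB)
    rwa [Category.id_comp] at this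
  let r : pullback z' γ ⟶ F := Over.homMk (θ ≫ b' ≫ b) (by
    have h₁ : f.left ≫ d₁ ≫ T.hom = F.hom := by
      rw [← Over.w f, ← Over.w (pullback.fst c γ)]
    have h₂ : (pullback.fst z' γ).left ≫ (p ≫ y) ≫ T.hom = (pullback z' γ).hom :=
      Over.w (pullback.fst z' γ)
    rw [← h₁, ← h₂, ← Category.assoc _ (p ≫ y), ← hθ.choose]
    simp only [Category.assoc])
  have hr : (r ≫ f).left = θ ≫ b' ≫ b ≫ f.left := by
    simp only [r, Over.comp_left, Over.homMk_left, Category.assoc]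
  have : Epi (p ≫ y) := epi_comp _ _
  refine ⟨T', Over.homMk (p ≫ y) rfl, z', r, ?_, ?_, ?_⟩
  · exact (Over.forget A).epi_of_epi_map this
  · apply IsQuasiPullback.of_left
    rw [hr]
    exact hθ
  · ext
    change (pullback.snd z' γ).left ≫ e ≫ m = (r ≫ f).left ≫ d₂ ≫ e ≫ m
    rw [hr, ← hθa, Category.assoc, reassoc_of% hae]
    simp only [Category.assoc]

end Collection

end PredTopos

theorem mainTheorem7 {E : Type u} [Category.{v} E] [PredTopos.PiWPretopos E]
    (S : MorphismProperty E) (hS : PredTopos.IsClassOfSmallMaps S)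
    (hrep : PredTopos.IsRepresentable S) (hCA : PredTopos.SatisfiesCollection S)
    (C : PredTopos.InternalCategory E) (J : PredTopos.Site C) (hJ : J.HasSmallCovers S) :
    ∃ J' : PredTopos.Site C,
      J'.IsCollectionSite ∧ J'.HasSmallCovers S ∧ J.Equivalent J' := by
  open PredTopos in
  obtain ⟨V, U, π, hπ, hU⟩ := hrep
  -- adding `φ` to the universe makes every covering family a fibre of `ρ`, not just locally so
  let ρ : V ⨿ J.Ix ⟶ U ⨿ J.Cov := coprod.map π J.φ
  obtain ⟨K, Q, u, k, q, c, e, hq, hqp, hK⟩ := exists_coverClassifier ρ J.φ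
  have hSq : S q := hS.pullback _ _ _ _ hq.flip (hS.sum _ _ hπ hJ)
  -- the identity reindexings
  obtain ⟨s, -, -, hs, -⟩ := hK coprod.inr (𝟙 J.Cov) J.φ coprod.inr (𝟙 J.Ix)
    (isPullback_inr_map π J.φ) (.of_isPullback (.of_horiz_isIso ⟨by simp⟩))
  refine ⟨J.reindex k q e s hqp hs,
    isCollectionSpanOver_of_reindexing hS.toIsStableClass hCA hSq hqp ?_ _ _ _ _, hSq,
    .of_isSheaf_eq (J.reindexing k q e s hqp hs).isSheaf_eq.symm⟩
  intro B A g k' e' hg he'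
  obtain ⟨B', A', g', b, p, c', u', hp, hb, hc'⟩ := hU g hg
  obtain ⟨z, a, ha, hz, hae⟩ := hK (u' ≫ coprod.inl) (p ≫ k') g' (c' ≫ coprod.inl) (b ≫ e')
    (hc'.flip.paste_vert (isPullback_inl_map π J.φ)) ((IsQuasiPullback.of_isPullback hb).paste he')
  exact ⟨B', A', p, b, g', z, a, hp, hb, ha, hz, hae⟩
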